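/- **Model.** Let $N\ge 1$. A $T$-query quantum algorithm on inputs $x\in\{0,1\}^N$ acts on a space with computational basis $|i,c,a,b,z\rangle$, where $i\in\{1,\dots,N\}$, $c,a,b\in\{0,1\}$ and $z\in\{0,1\}^m$ for some finite $m$. It starts in a fixed basis state and applies $U_T\,O_x\,U_{T-1}\cdots U_1\,O_x\,U_0$, where the $U_k$ are arbitrary unitaries independent of $x$ and the query is $O_x|i,c,a,b,z\rangle=|i,c\oplus x_i,a,b,z\rangle$; finally it is measured in the computational basis, giving two output bits $a,b$. Regarded as a *postselection algorithm*, it computes $f:\{0,1\}^N\to\{0,1\}$ with error probability $\le\varepsilon$ if for every $x\in\{0,1\}^N$ we have $\Pr[a=1]>0$ and $\Pr[b=f(x)\mid a=1]\ge 1-\varepsilon$. The majority function is $\mathrm{MAJ}_N(x)=1$ iff $|x|:=\sum_{i=1}^N x_i\ge N/2$. **Theorem.** There is a universal constant $C>0$ such that for every positive integer $N$ and every real $\varepsilon\in(2^{-N},1/2)$ there exists a postselection algorithm that computes $\mathrm{MAJ}_N$ with error probability $\le\varepsilon$ and makes at most $$C\cdot\log_2\!\left(\frac{2N}{\log_2(1/\varepsilon)}\right)\cdot\log_2(1/\varepsilon)$$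 queries to its input. -/

import Mathlib

open scoped Matrix

/-- Labels of the computational basis states `|i, c, a, b, z⟩` of a quantum query algorithm on
`N`-bit inputs: the query register `i` (an index of the input), the target qubit `c` of the query,
the two output qubits `a` and `b`, and `m` further workspace qubits `z`. -/
abbrev QBasis (N m : ℕ) : Type :=
  Fin N × Bool × Bool × Bool × (Fin m → Bool)

/-- State vectors, given by their complex amplitudes in the computational basis. -/
abbrev QState (N m : ℕ) : Type :=
  QBasis N m → ℂ

/-- One query to the input `x`: the linear map with
`|i, c, a, b, z⟩ ↦ |i, c ⊕ x i, a, b, z⟩` on basis states. Since this permutation of the basis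
is an involution, it acts on amplitudes as written here. -/
def oracleQuery {N m : ℕ} (x : Fin N → Bool) (ψ : QState N m) : QState N m :=
  fun s => ψ (s.1, xor s.2.1 (x s.1), s.2.2)

/-- A quantum query algorithm (with two output qubits) on `N`-bit inputs: it starts in a fixed
computational basis state and applies `U_T O_x U_{T-1} ⋯ U_1 O_x U_0`, where `T` is the number
of queries and the unitaries `U_k` do not depend on the input `x`. Only `U 0, …, U T` are used. -/
structure PostselectionAlgorithm (N : ℕ) where
  /-- the number of additional workspace qubits -/
  workspace : ℕ
  /-- the number `T` of queries -/
  queries : ℕ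
  /-- the label of the initial basis state -/
  start : QBasis N workspace
  /-- the input-independent unitaries -/
  U : ℕ → Matrix.unitaryGroup (QBasis N workspace) ℂ

namespace PostselectionAlgorithm

variable {N : ℕ} (A : PostselectionAlgorithm N)

/-- The state after `k` queries (and after the unitary `U k` that follows the `k`-th query). -/
def stateAfter (x : Fin N → Bool) : ℕ → QState N A.workspace
  | 0 => (A.U 0 : Matrix _ _ ℂ) *ᵥ Pi.single A.start 1
  | k + 1 => (A.U (k + 1) : Matrix _ _ ℂ) *ᵥ oracleQuery x (stateAfter x k)

/-- The final state, after all queries. -/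
def finalState (x : Fin N → Bool) : QState N A.workspace :=
  A.stateAfter x A.queries

/-- `Pr[a = 1]` when the final state is measured in the computational basis. -/
noncomputable def probPost (x : Fin N → Bool) : ℝ :=
  ∑ s : QBasis N A.workspace with s.2.2.1 = true, ‖A.finalState x s‖ ^ 2

/-- `Pr[a = 1 and b = v]` when the final state is measured in the computational basis. -/
noncomputable def probPostAnd (x : Fin N → Bool) (v : Bool) : ℝ :=
  ∑ s : QBasis N A.workspace with s.2.2.1 = true ∧ s.2.2.2.1 = v, ‖A.finalState x s‖ ^ 2

/-- `A` computes `f` with postselection with error probability at most `ε`: on every input `x`,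
`Pr[a = 1] > 0` and `Pr[b = f x | a = 1] ≥ 1 - ε`. -/
def ComputesWithError (f : (Fin N → Bool) → Bool) (ε : ℝ) : Prop :=
  ∀ x : Fin N → Bool,
    0 < A.probPost x ∧ 1 - ε ≤ A.probPostAnd x (f x) / A.probPost x

end PostselectionAlgorithm

/-- The Hamming weight `|x|`, the number of ones in `x`. -/
def boolWeight {N : ℕ} (x : Fin N → Bool) : ℕ :=
  (Finset.univ.filter fun i => x i = true).card

/-- The majority function: `MAJ_N(x) = 1` iff `|x| ≥ N / 2`, that is, iff `N ≤ 2 |x|`. -/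
def majority (N : ℕ) (x : Fin N → Bool) : Bool :=
  decide (N ≤ 2 * boolWeight x)

/-! Put y = 4|x| - 2N + 1, an odd integer that is positive exactly when the majority is 1.
Postselection discards normalization, so it suffices to give the outputs b = 1 and b = 0 amplitudes
proportional to ∏ (a_j + y) and ∏ (a_j - y), for nodes a_j > 0 making the wrong product much smaller
than the right one: a Newman-type rational approximation of the sign of y. Each factor is a linear
form in the phases (-1)^(x_i), so it costs one query: the product expands into a sum over index
sequences, which a superposition follows in parallel and a final projection onto the uniform state
adds up (`exists_algorithm_of_prod_linear`). With M nodes per dyadic scale, about log(N/M) scales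
suffice, and `prod_signNode_le` gives error 9^(-M). Taking M ≈ log(1/ε) yields the bound. -/

/-- An orthonormal family indexed by a set of basis labels is the image of the corresponding
basis vectors under a unitary matrix. -/
theorem exists_unitary_mulVec_single {Q : Type*} [Fintype Q] [DecidableEq Q] (S : Set Q)
    (v : Q → Q → ℂ)
    (hv : ∀ q ∈ S, ∀ r ∈ S, star (v q) ⬝ᵥ v r = if q = r then 1 else 0) :
    ∃ A : Matrix.unitaryGroup Q ℂ, ∀ q ∈ S,
      (A : Matrix Q Q ℂ) *ᵥ Pi.single q 1 = v q := by
  have ho : Orthonormal ℂ (S.domRestrict fun q => WithLp.toLp 2 (v q)) := by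
    rw [orthonormal_iff_ite]
    rintro ⟨q, hq⟩ ⟨r, hr⟩
    have := hv q hq r hr
    change inner ℂ (WithLp.toLp 2 (v q)) (WithLp.toLp 2 (v r)) = _
    rw [EuclideanSpace.inner_toLp_toLp, dotProduct_comm, this]
    simp
  obtain ⟨b, hb⟩ := ho.exists_orthonormalBasis_extension_of_card_eq (by simp)
  refine ⟨⟨(EuclideanSpace.basisFun Q ℂ).toBasis.toMatrix b,
    (EuclideanSpace.basisFun Q ℂ).toMatrix_orthonormalBasis_mem_unitary b⟩, fun q hq => ?_⟩
  ext r
  simp [Module.Basis.toMatrix_apply, hb q hq]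

/-! ### Phase kickback and projection onto uniform superpositions -/

namespace PostselectionAlgorithm

variable {N m : ℕ}

/-- The vector `|i⟩ ⊗ (|0⟩ + (-1) ^ c |1⟩) / √2 ⊗ |0, b, z⟩`. -/
noncomputable def phaseVector (p : Fin N × Bool) (b : Bool) (z : Fin m → Bool) : QState N m :=
  fun q => if q.1 = p.1 ∧ q.2.2 = (false, b, z) then
    (if p.2 && q.2.1 then -1 else 1) * ((√2 : ℝ) : ℂ)⁻¹ else 0

/-- The phase picked up by `phaseVector p b z` in a query to `x`. -/
def queryPhase (x : Fin N → Bool) (p : Fin N × Bool) : ℂ :=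
  if p.2 && x p.1 then -1 else 1

/-- Phase kickback: |0⟩ ± |1⟩ are eigenvectors of the bit flip. The plus sign gives a dummy query
with phase 1, which supplies the constant terms of linear forms. -/
theorem phaseVector_oracle (x : Fin N → Bool) (p : Fin N × Bool) (b : Bool) (z : Fin m → Bool) :
    oracleQuery x (phaseVector p b z) = queryPhase x p • phaseVector p b z := by
  obtain ⟨i, c⟩ := p
  ext ⟨j, d, w⟩
  simp only [oracleQuery, phaseVector, queryPhase, Pi.smul_apply, smul_eq_mul]
  by_cases h : j = i ∧ w = (false, b, z)
  · obtain ⟨rfl, rfl⟩ := h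
    cases c <;> cases d <;> cases x j <;> simp
  · simp [h]

theorem sum_qBasis (f : QBasis N m → ℂ) :
    ∑ q, f q = ∑ i, ∑ c, ∑ a, ∑ b, ∑ z, f (i, c, a, b, z) := by
  simp only [Fintype.sum_prod_type]

/-- Different labels (b, z) already force orthogonality, so `p` may be any function of the label,
injective or not. -/
theorem star_phaseVector_dotProduct (p p' : Fin N × Bool) (b b' : Bool) (z z' : Fin m → Bool)
    (hp : b = b' → z = z' → p = p') :
    star (phaseVector p b z) ⬝ᵥ phaseVector p' b' z' = if b = b' ∧ z = z' then 1 else 0 := by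
  have h2 : ((√2 : ℝ) : ℂ)⁻¹ * ((√2 : ℝ) : ℂ)⁻¹ = 1 / 2 := by
    rw [← mul_inv, ← Complex.ofReal_mul, Real.mul_self_sqrt (by norm_num)]; norm_num
  by_cases h : b = b' ∧ z = z'
  · obtain ⟨rfl, rfl⟩ := h
    obtain rfl := hp rfl rfl
    have h3 : ∀ c : Bool, ∑ a, ∑ b', ∑ z',
        star (phaseVector p b z) (p.1, c, a, b', z') * phaseVector p b z (p.1, c, a, b', z') =
          1 / 2 := by
      intro c
      rw [Fintype.sum_eq_single false, Fintype.sum_eq_single b, Fintype.sum_eq_single z]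
      · cases h : p.2 && c <;> simp [phaseVector, h, h2]
      all_goals
        intro j hj
        simp [phaseVector, hj]
    rw [dotProduct, sum_qBasis, Fintype.sum_eq_single p.1]
    · simp only [h3, and_self, if_true]
      norm_num
    · intro j hj
      simp [phaseVector, hj]
  · rw [if_neg h]
    refine Finset.sum_eq_zero fun q _ => ?_
    simp only [phaseVector, Pi.star_apply]
    by_cases h1 : q.2.2 = (false, b, z)
    · have : q.2.2 ≠ (false, b', z') := by
        rw [h1]; simpa using h
      simp [this]
    · simp [h1]

/-- The uniform superposition of the basis vectors `|i, 0, 0, b, z⟩` over all `z`. -/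
noncomputable def uniformVector (i : Fin N) (b : Bool) : QState N m :=
  fun q => if q.1 = i ∧ q.2.1 = false ∧ q.2.2.1 = false ∧ q.2.2.2.1 = b then
    ((√(2 ^ m : ℝ) : ℝ) : ℂ)⁻¹ else 0

theorem star_uniformVector_dotProduct (i : Fin N) (b : Bool) (φ : QState N m) :
    star (uniformVector i b) ⬝ᵥ φ =
      ((√(2 ^ m : ℝ) : ℝ) : ℂ)⁻¹ * ∑ z, φ (i, false, false, b, z) := by
  simp only [dotProduct, sum_qBasis]
  rw [Fintype.sum_eq_single i, Fintype.sum_eq_single false, Fintype.sum_eq_single false,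
    Fintype.sum_eq_single b, Finset.mul_sum]
  · simp [uniformVector]
  all_goals
    intro j hj
    simp [uniformVector, hj]

/-- A unitary that rotates the uniform superpositions `uniformVector i b` into basis states with
`a = 1`, and fixes all other basis states with `a = 1`. -/
theorem exists_unitary_uniform (i : Fin N) (z₀ : Fin m → Bool) :
    ∃ B : Matrix.unitaryGroup (QBasis N m) ℂ, ∀ (φ : QState N m),
      (∀ q, q.2.2.1 = true → φ q = 0) → ∀ q, q.2.2.1 = true →
      ((B : Matrix _ _ ℂ) *ᵥ φ) q =
        if q = (i, false, true, q.2.2.2.1, z₀) then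
          ((√(2 ^ m : ℝ) : ℝ) : ℂ)⁻¹ * ∑ z, φ (i, false, false, q.2.2.2.1, z) else 0 := by
  have hm : ((√(2 ^ m : ℝ) : ℝ) : ℂ)⁻¹ * (2 ^ m * ((√(2 ^ m : ℝ) : ℝ) : ℂ)⁻¹) = 1 := by
    have h1 : ((√(2 ^ m : ℝ) : ℝ) : ℂ) * ((√(2 ^ m : ℝ) : ℝ) : ℂ) = 2 ^ m := by
      rw [← Complex.ofReal_mul, Real.mul_self_sqrt (by positivity)]; push_cast; rfl
    have h0 : ((√(2 ^ m : ℝ) : ℝ) : ℂ) ≠ 0 := by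
      intro h; rw [h, zero_mul] at h1; exact pow_ne_zero m two_ne_zero h1.symm
    rw [← h1]; field_simp
  obtain ⟨A, hA⟩ := exists_unitary_mulVec_single {q : QBasis N m | q.2.2.1 = true}
    (fun q => if q = (i, false, true, q.2.2.2.1, z₀) then uniformVector i q.2.2.2.1
      else Pi.single q 1) (by
    rintro ⟨j, c, a, b, z⟩ ha ⟨j', c', a', b', z'⟩ ha'
    simp only [Set.mem_ofPred_eq] at ha ha'
    subst ha ha'
    by_cases h : (j, c, true, b, z) = ((i, false, true, b, z₀) : QBasis N m) <;>
    by_cases h' : (j', c', true, b', z') = ((i, false, true, b', z₀) : QBasis N m)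
    · simp only [Prod.mk.injEq] at h h'
      obtain ⟨rfl, rfl, -, -, rfl⟩ := h
      obtain ⟨rfl, rfl, -, -, rfl⟩ := h'
      simp only [if_true, star_uniformVector_dotProduct]
      by_cases hb : b = b'
      · subst hb; simpa [uniformVector] using hm
      · simp [uniformVector, hb]
    · simp only [if_pos h, if_neg h', star_uniformVector_dotProduct]
      have : ((j, c, true, b, z) : QBasis N m) ≠ (j', c', true, b', z') := by
        intro e; apply h'; simp only [Prod.mk.injEq] at e h ⊢; grind
      simp [this]
    · simp only [if_neg h, if_pos h']
      have : ((j, c, true, b, z) : QBasis N m) ≠ (j', c', true, b', z') := by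
        intro e; apply h; simp only [Prod.mk.injEq] at e h' ⊢; grind
      simp [this, uniformVector]
    · simp only [if_neg h, if_neg h', ← Pi.single_star, single_dotProduct, star_one, one_mul,
        Pi.single_apply])
  -- By unitarity, the amplitude of `A⁻¹ φ` at `q` is the inner product of `A |q⟩` with `φ`.
  refine ⟨A⁻¹, fun φ hφ q hq => ?_⟩
  have key : (((A⁻¹ : Matrix.unitaryGroup (QBasis N m) ℂ) : Matrix _ _ ℂ) *ᵥ φ) q =
      star ((A : Matrix _ _ ℂ) *ᵥ Pi.single q 1) ⬝ᵥ φ := by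
    simp [Matrix.mulVec, dotProduct, Matrix.star_apply]
  rw [key, hA q hq]
  split_ifs with h
  · rw [star_uniformVector_dotProduct]
  · simp [hφ q hq]

end PostselectionAlgorithm

/-! ### Sums and products of query phases as postselected amplitudes -/

namespace PostselectionAlgorithm

variable {N m : ℕ}

/-- The state `∑ β b z |i, 0, 0, b, z⟩`. -/
def baseState (i : Fin N) (β : Bool → (Fin m → Bool) → ℂ) : QState N m :=
  fun q => if q.1 = i ∧ q.2.1 = false ∧ q.2.2.1 = false then β q.2.2.2.1 q.2.2.2.2 else 0

theorem star_baseState_dotProduct (i : Fin N) (β : Bool → (Fin m → Bool) → ℂ) :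
    star (baseState i β) ⬝ᵥ baseState i β = ((∑ b, ∑ z, ‖β b z‖ ^ 2 : ℝ) : ℂ) := by
  simp only [dotProduct, sum_qBasis]
  rw [Fintype.sum_eq_single i, Fintype.sum_eq_single false, Fintype.sum_eq_single false]
  · simp [baseState, Complex.conj_mul']
  all_goals
    intro j hj
    simp [baseState, hj]

theorem mulVec_baseState (A : Matrix (QBasis N m) (QBasis N m) ℂ) (i : Fin N)
    (β : Bool → (Fin m → Bool) → ℂ) :
    A *ᵥ baseState i β =
      ∑ b, ∑ z, β b z • (A *ᵥ Pi.single (i, false, false, b, z) 1) := by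
  ext s
  simp only [Matrix.mulVec, dotProduct, sum_qBasis]
  rw [Fintype.sum_eq_single i, Fintype.sum_eq_single false, Fintype.sum_eq_single false]
  · simp [baseState, Matrix.mulVec_single, mul_comm]
  all_goals
    intro j hj
    simp [baseState, hj]

theorem exists_unitary_phaseVector (i : Fin N) (p : (Fin m → Bool) → Fin N × Bool) :
    ∃ A : Matrix.unitaryGroup (QBasis N m) ℂ, ∀ β : Bool → (Fin m → Bool) → ℂ,
      (A : Matrix _ _ ℂ) *ᵥ baseState i β = ∑ b, ∑ z, β b z • phaseVector (p z) b z := by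
  obtain ⟨A, hA⟩ := exists_unitary_mulVec_single
    {q : QBasis N m | q.1 = i ∧ q.2.1 = false ∧ q.2.2.1 = false}
    (fun q => phaseVector (p q.2.2.2.2) q.2.2.2.1 q.2.2.2.2) (by
    rintro ⟨j, c, a, b, z⟩ ⟨rfl, rfl, rfl⟩ ⟨j', c', a', b', z'⟩ ⟨h1, h2, h3⟩
    simp only at h1 h2 h3
    subst h1 h2 h3
    rw [star_phaseVector_dotProduct _ _ _ _ _ _ (fun _ h => by rw [h])]
    simp)
  refine ⟨A, fun β => ?_⟩
  rw [mulVec_baseState]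
  refine Finset.sum_congr rfl fun b _ => Finset.sum_congr rfl fun z _ => ?_
  rw [hA _ ⟨rfl, rfl, rfl⟩]

theorem exists_unitary_baseState (s : QBasis N m) (i : Fin N) (α : Bool → (Fin m → Bool) → ℂ)
    (hα : ∑ b, ∑ z, ‖α b z‖ ^ 2 = 1) :
    ∃ A : Matrix.unitaryGroup (QBasis N m) ℂ,
      (A : Matrix _ _ ℂ) *ᵥ Pi.single s 1 = baseState i α := by
  obtain ⟨A, hA⟩ := exists_unitary_mulVec_single {s} (fun _ => baseState i α) (by
    rintro q rfl r rfl
    rw [star_baseState_dotProduct, hα]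
    simp)
  exact ⟨A, hA s rfl⟩

theorem probPost_eq (A : PostselectionAlgorithm N) (x : Fin N → Bool) (v : Bool) :
    A.probPost x = A.probPostAnd x v + A.probPostAnd x (!v) := by
  simp only [probPost, probPostAnd]
  rw [← Finset.sum_filter_add_sum_filter_not _ (fun s => s.2.2.2.1 = v),
    Finset.filter_filter, Finset.filter_filter]
  congr 3
  ext s
  cases v <;> simp

/-- Superpositions of products of query phases are the postselected amplitudes of an algorithm. -/
theorem exists_algorithm_of_sum_phases (T : ℕ)
    (g : (Fin m → Bool) → ℕ → Fin N × Bool) (α : Bool → (Fin m → Bool) → ℂ)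
    (hα : ∑ b, ∑ z, ‖α b z‖ ^ 2 = 1) (i : Fin N) :
    ∃ A : PostselectionAlgorithm N, A.queries = T ∧ ∀ x v,
      A.probPostAnd x v = (2 ^ m : ℝ)⁻¹ *
        ‖∑ z, α v z * ∏ j ∈ Finset.range T, queryPhase x (g z j)‖ ^ 2 := by
  let s : QBasis N m := (i, false, false, false, fun _ => false)
  obtain ⟨R, hR⟩ := exists_unitary_baseState s i α hα
  obtain ⟨B, hB⟩ := exists_unitary_uniform i (fun _ : Fin m => false)
  choose P hP using fun k => exists_unitary_phaseVector i (fun z => g z k)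
  -- `P k` prepares the phase vectors for a query and its inverse, merged into the next unitary,
  -- undoes this. At index `T` no query remains, and `B` projects instead.
  let D : ℕ → Matrix.unitaryGroup (QBasis N m) ℂ := fun k => if k < T then P k else B
  let A : PostselectionAlgorithm N :=
    { workspace := m
      queries := T
      start := s
      U := fun k => match k with
        | 0 => D 0 * R
        | k + 1 => D (k + 1) * (D k)⁻¹ }
  let β : (Fin N → Bool) → ℕ → Bool → (Fin m → Bool) → ℂ := fun x k b z =>
    α b z * ∏ j ∈ Finset.range k, queryPhase x (g z j)
  have hstate : ∀ x k, k ≤ T →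
      A.stateAfter x k = (D k).1 *ᵥ
        baseState i (β x k) := by
    intro x k
    induction k with
    | zero =>
      intro _
      change (D 0 * R).1 *ᵥ Pi.single s 1 = _
      rw [Submonoid.coe_mul, ← Matrix.mulVec_mulVec, hR]
      congr 2
      ext b z
      simp [β]
    | succ k ih =>
      intro hk
      have horacle : oracleQuery x ((D k).1 *ᵥ baseState i (β x k)) =
          (D k).1 *ᵥ
            baseState i (β x (k + 1)) := by
        have hD : D k = P k := if_pos hk
        rw [hD, hP, hP]
        ext q
        simp only [oracleQuery, Finset.sum_apply, Pi.smul_apply, smul_eq_mul]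
        refine Finset.sum_congr rfl fun b _ => Finset.sum_congr rfl fun z _ => ?_
        have := congrFun (phaseVector_oracle x (g z k) b z) q
        simp only [oracleQuery, Pi.smul_apply, smul_eq_mul] at this
        rw [this]
        simp only [β, Finset.prod_range_succ]
        ring
      change (D (k + 1) * (D k)⁻¹).1 *ᵥ
        oracleQuery x (A.stateAfter x k) = _
      rw [ih (by omega), horacle, Matrix.mulVec_mulVec, ← Submonoid.coe_mul, inv_mul_cancel_right]
  have hfinal : ∀ x (q : QBasis N m), q.2.2.1 = true → A.finalState x q =
      if q = (i, false, true, q.2.2.2.1, fun _ => false) then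
        ((√(2 ^ m : ℝ) : ℝ) : ℂ)⁻¹ * ∑ z, β x T q.2.2.2.1 z else 0 := by
    intro x q hq
    have h1 : A.finalState x = (B : Matrix _ _ ℂ) *ᵥ baseState i (β x T) := by
      have := hstate x T le_rfl
      rw [show D T = B from if_neg (lt_irrefl T)] at this
      exact this
    rw [h1, hB _ _ q hq]
    · simp [baseState]
    · intro q hq
      simp [baseState, hq]
  refine ⟨A, rfl, fun x v => ?_⟩
  rw [probPostAnd, Finset.sum_eq_single_of_mem
    ((i, false, true, v, fun _ => false) : QBasis N m)]
  · rw [hfinal x _ rfl, if_pos rfl, norm_mul, mul_pow, norm_inv, Complex.norm_real,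
      Real.norm_of_nonneg (Real.sqrt_nonneg _), inv_pow, Real.sq_sqrt (by positivity)]
  · simp
  · rintro q hq hne
    simp only [Finset.mem_filter, Finset.mem_univ, true_and] at hq
    rw [hfinal x q hq.1, if_neg]
    · simp
    · rw [hq.2]; exact hne

/-- Products of linear forms in the query phases, with a common factor, are the postselected
amplitudes of an algorithm with one query per linear form. -/
theorem exists_algorithm_of_prod_linear (T : ℕ) (i : Fin N)
    (w : Bool → Fin T → Fin N × Bool → ℂ) (hw : ∃ b, ∀ j, ∃ p, w b j p ≠ 0) :
    ∃ A : PostselectionAlgorithm N, A.queries = T ∧ ∃ κ : ℝ, 0 < κ ∧ ∀ x v,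
      A.probPostAnd x v = κ * ‖∏ j, ∑ p, w v j p * queryPhase x p‖ ^ 2 := by
  -- Each term of the expanded product is a choice function, stored in the workspace as a bit
  -- string. Strings outside the range of `e` get amplitude 0.
  obtain ⟨e⟩ : Nonempty ((Fin T → Fin N × Bool) ↪
      (Fin (Fintype.card (Fin T → Fin N × Bool)) → Bool)) := by
    refine Function.Embedding.nonempty_of_card_le ?_
    simpa using (Nat.lt_two_pow_self (n := Fintype.card (Fin T → Fin N × Bool))).le
  set m := Fintype.card (Fin T → Fin N × Bool)
  have : Nonempty (Fin T → Fin N × Bool) := ⟨fun _ => (i, false)⟩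
  let α : Bool → (Fin m → Bool) → ℂ := fun b => Function.extend e (fun f => ∏ j, w b j (f j)) 0
  let S : ℝ := ∑ b, ∑ z, ‖α b z‖ ^ 2
  have hS : 0 < S := by
    obtain ⟨b, hb⟩ := hw
    choose f hf using hb
    refine Finset.sum_pos' (fun _ _ => by positivity) ⟨b, Finset.mem_univ _, ?_⟩
    refine Finset.sum_pos' (fun _ _ => by positivity) ⟨e f, Finset.mem_univ _, ?_⟩
    have : α b (e f) ≠ 0 := by
      simp only [α, e.injective.extend_apply]
      exact Finset.prod_ne_zero_iff.2 fun j _ => hf j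
    positivity
  let g : (Fin m → Bool) → ℕ → Fin N × Bool := fun z k =>
    if h : k < T then Function.invFun e z ⟨k, h⟩ else (i, false)
  obtain ⟨A, hA, hP⟩ := exists_algorithm_of_sum_phases T g
    (fun b z => ((√S : ℝ) : ℂ)⁻¹ * α b z) (by
      simp only [norm_mul, mul_pow, norm_inv, Complex.norm_real, inv_pow,
        Real.norm_of_nonneg (Real.sqrt_nonneg _), Real.sq_sqrt hS.le, ← Finset.mul_sum]
      exact inv_mul_cancel₀ hS.ne') i
  refine ⟨A, hA, (2 ^ m : ℝ)⁻¹ * S⁻¹, by positivity, fun x v => ?_⟩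
  have hsum : ∑ z, α v z * ∏ j ∈ Finset.range T, queryPhase x (g z j) =
      ∏ j, ∑ p, w v j p * queryPhase x p := by
    rw [Finset.prod_univ_sum, Fintype.piFinset_univ]
    symm
    refine Fintype.sum_of_injective e e.injective _ _ (fun z hz => ?_) fun f => ?_
    · have : α v z = 0 := Function.extend_apply' _ _ _ hz
      rw [this, zero_mul]
    · simp only [α, e.injective.extend_apply, Finset.prod_mul_distrib, Finset.prod_range]
      congr 1
      refine Finset.prod_congr rfl fun j _ => ?_
      simp [g, Function.leftInverse_invFun e.injective f]
  rw [hP, ← hsum]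
  simp only [mul_assoc, ← Finset.mul_sum]
  rw [norm_mul, mul_pow, norm_inv, Complex.norm_real, inv_pow,
    Real.norm_of_nonneg (Real.sqrt_nonneg _), Real.sq_sqrt hS.le]

end PostselectionAlgorithm

/-! ### Rational approximation of the sign function -/

theorem abs_sub_le_abs_add {a t : ℝ} (ha : 0 ≤ a) (ht : 0 ≤ t) : |a - t| ≤ |a + t| := by
  rw [abs_of_nonneg (add_nonneg ha ht), abs_le]
  constructor <;> linarith

/-- The nodes of a rational approximation of the sign function, in `S + 1` groups of size `M`:
the first `M` odd numbers, and the `M`-fold numbers `M`, `2 * M`, …, `2 ^ (S - 1) * M`. -/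
def signNode (M S : ℕ) (j : Fin (S + 1) × Fin M) : ℕ :=
  if (j.1 : ℕ) = 0 then 2 * j.2 + 1 else M * 2 ^ ((j.1 : ℕ) - 1)

theorem signNode_pos {M S : ℕ} (j : Fin (S + 1) × Fin M) : 0 < signNode M S j := by
  have := j.2.pos
  unfold signNode
  split_ifs <;> positivity

/-- If t < M, then t is itself a node and the left side vanishes. Otherwise M * 2^s ≤ t < M *
2^(s+1) for some s < S, and each of the M copies of the node a = M * 2^s contributes a ratio (t - a)
/ (t + a) < 1/3. No other factor has ratio above 1. -/
theorem prod_signNode_le {M S t : ℕ} (hM : 0 < M) (ht : Odd t) (htS : t < M * 2 ^ S) :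
    ∏ j, |(signNode M S j : ℝ) - t| ≤
      (1 / 3) ^ M * ∏ j, |(signNode M S j : ℝ) + t| := by
  have hle : ∀ j, |(signNode M S j : ℝ) - t| ≤ |(signNode M S j : ℝ) + t| := fun j =>
    abs_sub_le_abs_add (Nat.cast_nonneg _) (Nat.cast_nonneg _)
  rcases lt_or_ge t M with h | h
  · obtain ⟨r, rfl⟩ := ht
    rw [Finset.prod_eq_zero (Finset.mem_univ ((0, ⟨r, by omega⟩) : Fin (S + 1) × Fin M))]
    · positivity
    · simp [signNode]
  · have hex : ∃ s, t < M * 2 ^ s := ⟨S, htS⟩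
    classical
    obtain ⟨s, hs⟩ : ∃ s, Nat.find hex = s + 1 := by
      refine Nat.exists_eq_succ_of_ne_zero fun h0 => ?_
      have := Nat.find_spec hex
      rw [h0] at this
      omega
    have hs1 : t < M * 2 ^ (s + 1) := hs ▸ Nat.find_spec hex
    have hs2 : M * 2 ^ s ≤ t := not_lt.1 (Nat.find_min hex (by omega))
    have hsS : s + 1 ≤ S := hs ▸ Nat.find_min' hex htS
    simp only [Fintype.prod_prod_type]
    let k : Fin (S + 1) := ⟨s + 1, by omega⟩
    rw [← Finset.mul_prod_erase _ _ (Finset.mem_univ k),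
      ← Finset.mul_prod_erase _ (fun i => ∏ j, |(signNode M S (i, j) : ℝ) + t|)
        (Finset.mem_univ k), ← mul_assoc]
    refine mul_le_mul ?_ ?_ (by positivity) (by positivity)
    · have hk : ∀ j, (signNode M S (k, j) : ℝ) = M * 2 ^ s := fun j => by simp [signNode, k]
      simp only [hk, Finset.prod_const, Finset.card_univ, Fintype.card_fin, ← mul_pow]
      have h1 : (t : ℝ) < M * 2 ^ s * 2 := by
        rw [pow_succ, ← mul_assoc] at hs1; exact_mod_cast hs1
      have h2 : (M : ℝ) * 2 ^ s ≤ t := by exact_mod_cast hs2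
      refine pow_le_pow_left₀ (abs_nonneg _) ?_ _
      rw [abs_of_nonpos (by linarith), abs_of_nonneg (by positivity)]
      linarith
    · exact Finset.prod_le_prod (fun _ _ => by positivity) fun i _ =>
        Finset.prod_le_prod (fun _ _ => by positivity) fun j _ => hle (i, j)

/-! ### The algorithm for majority -/

namespace PostselectionAlgorithm

theorem sum_queryPhase {N : ℕ} (x : Fin N → Bool) :
    ∑ i, queryPhase x (i, true) = (N : ℂ) - 2 * boolWeight x := by
  have h : ∀ i, queryPhase x (i, true) = 1 - 2 * (if x i = true then 1 else 0) := by
    intro i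
    cases hx : x i <;> simp [queryPhase, hx]
    norm_num
  simp only [h, Finset.sum_sub_distrib, ← Finset.mul_sum]
  simp [boolWeight]

theorem exists_algorithm_majority {N M S : ℕ} (hN : 0 < N) (hM : 0 < M)
    (hS : 2 * N + 1 < M * 2 ^ S) :
    ∃ A : PostselectionAlgorithm N, A.queries = (S + 1) * M ∧
      A.ComputesWithError (majority N) ((1 / 9) ^ M) := by
  have : NeZero N := ⟨hN.ne'⟩
  have hNC : (N : ℂ) ≠ 0 := Nat.cast_ne_zero.2 hN.ne'
  let e : Fin (S + 1) × Fin M ≃ Fin ((S + 1) * M) := finProdFinEquiv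
  let a : Fin ((S + 1) * M) → ℕ := fun j => signNode M S (e.symm j)
  let σ : Bool → ℝ := fun b => if b then 1 else -1
  -- The true phases sum to N - 2|x|, so weight -2σ gives σ(4|x| - 2N). The N dummy phases share the
  -- constant a_j + σ.
  obtain ⟨A, hA, κ, hκ, hP⟩ := exists_algorithm_of_prod_linear ((S + 1) * M)
    (0 : Fin N) (fun b j p => if p.2 then -2 * (σ b : ℂ) else ((a j : ℂ) + σ b) / N)
    ⟨true, fun j => ⟨(0, true), by simp [σ]⟩⟩
  refine ⟨A, hA, fun x => ?_⟩
  have hlin : ∀ v j, ∑ p : Fin N × Bool,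
      (if p.2 then -2 * (σ v : ℂ) else ((a j : ℂ) + σ v) / N) * queryPhase x p =
        (((a j : ℝ) + σ v * (4 * boolWeight x - 2 * N + 1) : ℝ) : ℂ) := by
    intro v j
    have h0 : ∀ i, queryPhase x (i, false) = 1 := fun i => by simp [queryPhase]
    simp only [Fintype.sum_prod_type, Fintype.sum_bool, if_true, Bool.false_eq_true, if_false,
      Finset.sum_add_distrib, ← Finset.mul_sum, sum_queryPhase, h0]
    simp
    field_simp
    ring
  have hprob : ∀ v, A.probPostAnd x v = κ *
      (∏ j, |(signNode M S j : ℝ) + σ v * (4 * boolWeight x - 2 * N + 1)|) ^ 2 := by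
    intro v
    rw [hP]
    simp only [hlin, norm_prod, Complex.norm_real, Real.norm_eq_abs]
    rw [← e.symm.prod_comp]
  -- t = |4|x| - 2N + 1| ≤ 2N + 1; the shift by 1 rules out zero and settles ties in favour of 1.
  obtain ⟨t, ht, htS, hr, hw⟩ : ∃ t : ℕ, Odd t ∧ t < M * 2 ^ S ∧
      σ (majority N x) * (4 * boolWeight x - 2 * N + 1) = t ∧
      σ (!majority N x) * (4 * boolWeight x - 2 * N + 1) = -t := by
    have hx : boolWeight x ≤ N := (Finset.card_le_univ _).trans_eq (Fintype.card_fin N)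
    by_cases h : N ≤ 2 * boolWeight x
    · refine ⟨4 * boolWeight x - 2 * N + 1, ⟨2 * boolWeight x - N, by omega⟩, by omega, ?_⟩
      simp only [majority, h, decide_true, σ]
      push_cast [Nat.cast_sub (show 2 * N ≤ 4 * boolWeight x by omega)]
      simp
    · refine ⟨2 * N - (4 * boolWeight x + 1), ⟨N - (2 * boolWeight x + 1), by omega⟩,
        by omega, ?_⟩
      simp only [majority, h, decide_false, σ]
      push_cast [Nat.cast_sub (show 4 * boolWeight x + 1 ≤ 2 * N by omega)]
      constructor <;> simp <;> ring
  have hle := prod_signNode_le hM ht htS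
  set W := ∏ j, |(signNode M S j : ℝ) - t|
  set R := ∏ j, |(signNode M S j : ℝ) + t|
  have hW : 0 ≤ W := by positivity
  have hR : 0 < R := Finset.prod_pos fun j _ => by
    have : (0 : ℝ) < signNode M S j := Nat.cast_pos.2 (signNode_pos j)
    positivity
  have hsq : W ^ 2 ≤ (1 / 9) ^ M * R ^ 2 := by
    refine (pow_le_pow_left₀ hW hle 2).trans_eq ?_
    rw [mul_pow, ← pow_mul, mul_comm M, pow_mul]
    norm_num
  have h1 : A.probPostAnd x (majority N x) = κ * R ^ 2 := by rw [hprob, hr]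
  have h2 : A.probPostAnd x (!majority N x) = κ * W ^ 2 := by
    rw [hprob, hw]; simp only [← sub_eq_add_neg]; rfl
  have hpos : 0 < A.probPost x := by
    rw [A.probPost_eq x (majority N x), h1, h2]
    positivity
  refine ⟨hpos, ?_⟩
  rw [le_div_iff₀ hpos, A.probPost_eq x (majority N x), h1, h2]
  -- The wrong weight κW² is at most 9^(-M) κR², hence at most 9^(-M) times the total κ(R² + W²).
  have h3 : (0 : ℝ) ≤ (1 / 9) ^ M * (κ * W ^ 2) := by positivity
  have h4 := mul_le_mul_of_nonneg_left hsq hκ.le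
  nlinarith

theorem ComputesWithError.mono {N : ℕ} {A : PostselectionAlgorithm N}
    {f : (Fin N → Bool) → Bool} {δ ε : ℝ} (h : A.ComputesWithError f δ) (hδ : δ ≤ ε) :
    A.ComputesWithError f ε :=
  fun x => ⟨(h x).1, (sub_le_sub_left hδ 1).trans (h x).2⟩

end PostselectionAlgorithm

/-! ### Choice of parameters and query count -/

theorem mainTheorem3 :
    ∃ C : ℝ, 0 < C ∧
      ∀ (N : ℕ) (ε : ℝ), 1 / (2 : ℝ) ^ N < ε → ε < 1 / 2 →
        ∃ A : PostselectionAlgorithm N,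
          A.ComputesWithError (majority N) ε ∧
          (A.queries : ℝ) ≤
            C * (Real.logb 2 (2 * (N : ℝ) / Real.logb 2 (1 / ε)) * Real.logb 2 (1 / ε)) := by
  -- 8 = 4 · 2: the number of groups is s + 2 ≤ 3 + ℓ ≤ 4ℓ, and M ≤ 2L. Both use strict bounds on ε:
  -- L < N gives ℓ ≥ 1, and L > 1 absorbs the rounding in M.
  refine ⟨8, by norm_num, fun N ε hε hε' => ?_⟩
  have hε0 : 0 < ε := lt_trans (by positivity) hε
  set L := Real.logb 2 (1 / ε) with hL
  have hεL : (2 : ℝ) ^ (-L) = ε := by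
    rw [hL, one_div, Real.logb_inv, neg_neg, Real.rpow_logb two_pos (by norm_num) hε0]
  have hL1 : 1 < L := by
    rw [hL, Real.lt_logb_iff_rpow_lt one_lt_two (by positivity), Real.rpow_one,
      lt_one_div two_pos hε0]
    exact hε'
  have hLN : L < N := by
    rw [hL, Real.logb_lt_iff_lt_rpow one_lt_two (by positivity), Real.rpow_natCast,
      one_div_lt hε0 (by positivity)]
    exact hε
  have hL0 : 0 < L := one_pos.trans hL1
  have hN : 0 < N := Nat.cast_pos.1 (hL0.trans hLN)
  have hN1 : (1 : ℝ) ≤ N := Nat.one_le_cast.2 hN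
  let M := ⌈L⌉₊
  have hM : 0 < M := Nat.ceil_pos.2 hL0
  have hLM : L ≤ M := Nat.le_ceil L
  have hML : (M : ℝ) ≤ 2 * L := by
    have := Nat.ceil_lt_add_one hL0.le
    change (⌈L⌉₊ : ℝ) ≤ _
    linarith
  let s := Nat.log 2 ((2 * N + 1) / M)
  have hS : 2 * N + 1 < M * 2 ^ (s + 1) := by
    rw [mul_comm M, ← Nat.div_lt_iff_lt_mul hM]
    exact Nat.lt_pow_succ_log_self one_lt_two _
  obtain ⟨A, hA, hAε⟩ := PostselectionAlgorithm.exists_algorithm_majority hN hM hS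
  refine ⟨A, hAε.mono ?_, ?_⟩
  · calc ((1 / 9 : ℝ)) ^ M ≤ (1 / 2) ^ M := by gcongr; norm_num
      _ = (2 : ℝ) ^ (-(M : ℝ)) := by
        rw [Real.rpow_neg two_pos.le, Real.rpow_natCast, one_div, inv_pow]
      _ ≤ (2 : ℝ) ^ (-L) := by gcongr; norm_num
      _ = ε := hεL
  · set ℓ := Real.logb 2 (2 * (N : ℝ) / L)
    have hℓ : 1 ≤ ℓ := by
      rw [Real.le_logb_iff_rpow_le one_lt_two (by positivity), Real.rpow_one, le_div_iff₀ hL0]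
      linarith
    have hMN : M ≤ 2 * N + 1 := by
      have : M ≤ N := Nat.ceil_le.2 hLN.le
      omega
    have hs : (s : ℝ) ≤ 1 + ℓ := by
      have h1 : (2 : ℝ) ^ (s : ℝ) ≤ 2 * (2 * N / L) := by
        rw [Real.rpow_natCast]
        calc (2 : ℝ) ^ s ≤ ((2 * N + 1) / M : ℕ) := by
              exact_mod_cast Nat.pow_log_le_self 2 (Nat.div_pos hMN hM).ne'
          _ ≤ ((2 * N + 1 : ℕ) : ℝ) / M := Nat.cast_div_le
          _ ≤ (2 * (2 * N)) / L := by
              push_cast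
              gcongr
              linarith
          _ = 2 * (2 * N / L) := by ring
      have h2 := (Real.le_logb_iff_rpow_le one_lt_two (by positivity)).2 h1
      rwa [Real.logb_mul two_ne_zero (by positivity), Real.logb_self_eq_one one_lt_two] at h2
    rw [hA]
    push_cast
    calc ((s : ℝ) + 1 + 1) * M ≤ (4 * ℓ) * (2 * L) := by
          gcongr
          linarith
      _ = 8 * (ℓ * L) := by ring
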